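/- Let $\mathcal K$ be a finite dimensional complex Hilbert space, $\mathcal O$ the $*$-algebra of all linear maps $\mathcal K\to\mathcal K$ with its operator norm, and $|X|=\sqrt{X^*X}$ for $X\in\mathcal O$. A state is an operator $\rho\in\mathcal O$ with $\rho\ge 0$ and $\operatorname{tr}\rho=1$; one writes $\rho(X)=\operatorname{tr}(\rho X)$, and $\rho$ is called faithful if $\rho>0$, i.e. if moreover $\operatorname{Ker}\rho=\{0\}$. Let $\rho,\nu$ be states and $\alpha\in\,]0,1[$, and set $S_\alpha(\rho|\nu)=\log\operatorname{tr}(\rho^\alpha\nu^{1-\alpha})\in[-\infty,\infty[$, where $\rho^\alpha$ and $\nu^{1-\alpha}$ vanish on $\operatorname{Ker}\rho$ and $\operatorname{Ker}\nu$ respectively, and where $\log 0=-\infty$, $\log\infty=\infty$. Let $\mathbb R_+$ be $[0,\infty[$ or $]0,\infty[$ (the statement holds for both), and let $C(\mathbb R_+,\mathcal O)$ be the set of continuous functions $A:\mathbb R_+\to\mathcal O$. Then $$S_\alpha(\rho|\nu)=\inf_{A\in C(\mathbb R_+,\mathcal O)}\log\left[\frac{\sin\pi\alpha}{\pi}\int_0^\infty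 t^{\alpha-1}\left(\frac1t\,\rho\big(|A(t)^*|^2\big)+\nu\big(|\mathbb 1-A(t)|^2\big)\right)dt\right],$$ where the integral of the non-negative integrand takes values in $[0,\infty]$. Moreover, for every $t>0$ the integral in $$A_{\rm opt}(t)=t\int_0^\infty e^{-s\rho}\,\nu\,e^{-st\nu}\,ds$$ converges absolutely, the function $A_{\rm opt}$ so defined on $]0,\infty[$ (extended by continuity to $t=0$ if $\mathbb R_+=[0,\infty[$, which is possible) belongs to $C(\mathbb R_+,\mathcal O)$, and the infimum is attained at $A_{\rm opt}$. If $\rho$ or $\nu$ is faithful, then $A_{\rm opt}$ is the unique element of $C(\mathbb R_+,\mathcal O)$ at which the infimum is attained. -/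

import Mathlib

noncomputable section

namespace Kosaki

open MeasureTheory

variable {K : Type*} [NormedAddCommGroup K] [InnerProductSpace ℂ K] [FiniteDimensional ℂ K]

/-- The trace of an operator on the finite dimensional Hilbert space `K`. -/
def opTrace (A : K →L[ℂ] K) : ℂ := LinearMap.trace ℂ K (A : K →ₗ[ℂ] K)

/-- A state (density matrix): a non-negative operator of trace one. Here `0 ≤ ρ` is the Loewner
order, that is, `⟪ψ, ρ ψ⟫ ≥ 0` for all `ψ`. -/
def IsState (ρ : K →L[ℂ] K) : Prop := 0 ≤ ρ ∧ opTrace ρ = 1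

/-- A state is faithful if it is strictly positive, that is, non-negative with trivial kernel. -/
def IsFaithful (ρ : K →L[ℂ] K) : Prop := 0 ≤ ρ ∧ LinearMap.ker (ρ : K →ₗ[ℂ] K) = ⊥

/-- The linear functional `A ↦ tr (ρ A)` identified with the density matrix `ρ`. -/
def expect (ρ A : K →L[ℂ] K) : ℂ := opTrace (ρ * A)

variable [CompleteSpace K]

/-- The Rényi relative entropy `S_α(ρ|ν) = log tr (ρ^α ν^(1-α))`, with `log 0 = -∞`.
For `0 < α < 1` the powers of `ρ, ν ≥ 0` given by the functional calculus vanish on the kernels.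
The trace is a non-negative real number, so taking its real part loses nothing. -/
def renyi (α : ℝ) (ρ ν : K →L[ℂ] K) : EReal :=
  ENNReal.log (ENNReal.ofReal (opTrace (ρ ^ α * ν ^ (1 - α))).re)

/-- The integrand `t^(α-1) (t⁻¹ ρ(|X^*|²) + ν(|1 - X|²))`, where `X` is the value at `t`
of the trial function. For states `ρ`, `ν` both expectations are non-negative real numbers. -/
def integrand (α : ℝ) (ρ ν : K →L[ℂ] K) (t : ℝ) (X : K →L[ℂ] K) : ℝ :=
  t ^ (α - 1) *
    (t⁻¹ * (expect ρ (CFC.abs (star X) ^ 2)).re + (expect ν (CFC.abs (1 - X) ^ 2)).re)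

/-- The functional `log [(sin πα / π) ∫_0^∞ t^(α-1) (t⁻¹ ρ(|A(t)^*|²) + ν(|1 - A(t)|²)) dt]`.
The integral of the non-negative integrand may be infinite, and `log 0 = -∞`, `log ∞ = ∞`. -/
def functional (α : ℝ) (ρ ν : K →L[ℂ] K) (A : ℝ → K →L[ℂ] K) : EReal :=
  ENNReal.log (ENNReal.ofReal (Real.sin (Real.pi * α) / Real.pi) *
    ∫⁻ t in Set.Ioi (0 : ℝ), ENNReal.ofReal (integrand α ρ ν t (A t)))

/-- The operator `e^{-sρ} ν e^{-stν}`. -/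
def optKernel (ρ ν : K →L[ℂ] K) (t s : ℝ) : K →L[ℂ] K :=
  NormedSpace.exp (-(s • ρ)) * ν * NormedSpace.exp (-((s * t) • ν))

/-- The operator `t ∫_0^∞ e^{-sρ} ν e^{-stν} ds` (meaningful for `t > 0`). -/
def optimizer (ρ ν : K →L[ℂ] K) (t : ℝ) : K →L[ℂ] K :=
  t • ∫ s in Set.Ioi (0 : ℝ), optKernel ρ ν t s

end Kosaki

end

open MeasureTheory InnerProductSpace

namespace Kosaki

/-! ### Operators, the functional calculus and eigenvectors. -/

section Spectral

variable {K : Type*} [NormedAddCommGroup K] [InnerProductSpace ℂ K]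

/-! Take orthonormal eigenbases `e` of `ρ` and `f` of `ν`, with eigenvalues `p i` and `q j`, and
record an operator by its elements between `e i` and `f j`. The integrand then decouples into
independent scalar problems: minimise `t⁻¹ p ‖a‖² + q ‖c - a‖²` over `a`, where `c` is the overlap
of the two basis vectors. Completing the square (`quadratic_eq_add_sq`) gives the minimiser `tq / (p
+ tq) * c` and the minimum `pq / (p + tq) * ‖c‖²`.

The Mellin transform of that minimum (`lintegral_rpow_mul_div_add`) is `π / sin πα` times `p^α
q^(1-α) ‖c‖²`, and these terms sum to the trace. The minimisers are the elements of `optimizer`,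
because the integral of `q e^{-(p + tq)s}` over `s > 0` is `q / (p + tq)`.

Uniqueness holds because the squared deviation from the minimiser has weight `t⁻¹ p + q`, positive
when a state is faithful; continuity upgrades almost everywhere to everywhere. -/

lemma IsFaithful.eigenvalue_ne_zero {ρ : K →L[ℂ] K} (hρ : IsFaithful ρ) {v : K} (hv : v ≠ 0)
    {x : ℝ} (hx : ρ v = (x : ℂ) • v) : x ≠ 0 := by
  rintro rfl
  have hmem : v ∈ LinearMap.ker (ρ : K →ₗ[ℂ] K) := by simpa using hx
  rw [hρ.2] at hmem
  exact hv (by simpa using hmem)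

lemma aeval_apply_eigenvector {a : K →L[ℂ] K} {v : K} {x : ℝ} (hv : a v = (x : ℂ) • v)
    (q : Polynomial ℝ) : Polynomial.aeval a q v = ((q.eval x : ℝ) : ℂ) • v := by
  induction q using Polynomial.induction_on with
  | C r => simp [Algebra.algebraMap_eq_smul_one]
  | add p q hp hq => simp [hp, hq, add_smul]
  | monomial n r h =>
    rw [pow_succ, ← mul_assoc, map_mul, Polynomial.aeval_X, mul_apply_eq_comp, hv,
      map_smul, h, smul_smul]
    congr 1
    simp
    ring

lemma ext_inner_basis {ι κ : Type*} [Fintype ι] [Fintype κ] {A B : K →L[ℂ] K}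
    (e : OrthonormalBasis ι ℂ K) (f : OrthonormalBasis κ ℂ K)
    (h : ∀ i j, inner ℂ (e i) (A (f j)) = inner ℂ (e i) (B (f j))) : A = B := by
  refine ContinuousLinearMap.coe_injective (f.toBasis.ext fun j => ?_)
  simp only [OrthonormalBasis.coe_toBasis]
  exact InnerProductSpace.ext_inner_left_basis e.toBasis fun i => by simpa using h i j

lemma inner_sum_rankOne {ι κ : Type*} [Fintype ι] [Fintype κ]
    (e : OrthonormalBasis ι ℂ K) (f : OrthonormalBasis κ ℂ K)
    (k : ι → κ → ℂ) (i : ι) (j : κ) :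
    inner ℂ (e i) ((∑ i, ∑ j, k i j • rankOne ℂ (e i) (f j)) (f j)) = k i j := by
  classical
  simp [orthonormal_iff_ite.1 e.orthonormal, orthonormal_iff_ite.1 f.orthonormal]

section Complete

variable [CompleteSpace K]

lemma inner_apply_eigenvector {a : K →L[ℂ] K} (ha : IsSelfAdjoint a) {v : K} {x : ℝ}
    (hv : a v = (x : ℂ) • v) (w : K) : inner ℂ v (a w) = (x : ℂ) * inner ℂ v w := by
  rw [← ContinuousLinearMap.adjoint_inner_left, ← ContinuousLinearMap.star_eq_adjoint, ha.star_eq,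
    hv, inner_smul_left]
  simp

lemma exp_neg_smul_isSelfAdjoint {a : K →L[ℂ] K} (ha : IsSelfAdjoint a) (s : ℝ) :
    IsSelfAdjoint (NormedSpace.exp (-(s • a))) := by
  rw [← CFC.real_exp_eq_normedSpace_exp ((IsSelfAdjoint.all s).smul ha).neg]
  exact IsSelfAdjoint.cfc

end Complete

variable [FiniteDimensional ℂ K]

lemma exists_eigenbasis {ρ : K →L[ℂ] K} (hρ : 0 ≤ ρ) :
    ∃ (e : OrthonormalBasis (Fin (Module.finrank ℂ K)) ℂ K) (p : Fin (Module.finrank ℂ K) → ℝ),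
      (∀ i, 0 ≤ p i) ∧ ∀ i, ρ (e i) = (p i : ℂ) • e i := by
  have hpos := (ρ.nonneg_iff_isPositive.1 hρ).toLinearMap
  exact ⟨hpos.isSymmetric.eigenvectorBasis rfl, hpos.isSymmetric.eigenvalues rfl,
    fun i => hpos.nonneg_eigenvalues rfl i, fun i => hpos.isSymmetric.apply_eigenvectorBasis rfl i⟩

variable [CompleteSpace K]

lemma finite_real_spectrum (a : K →L[ℂ] K) : (spectrum ℝ a).Finite := by
  have h : (spectrum ℂ a).Finite := by
    rw [ContinuousLinearMap.spectrum_eq]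
    exact Module.End.finite_spectrum _
  rw [← spectrum.preimage_algebraMap ℂ]
  exact h.preimage (FaithfulSMul.algebraMap_injective ℝ ℂ).injOn

/-- In finite dimension, the functional calculus acts on eigenvectors by evaluation. -/
lemma cfc_apply_eigenvector {a : K →L[ℂ] K} (ha : IsSelfAdjoint a) {v : K} {x : ℝ}
    (hv : a v = (x : ℂ) • v) (f : ℝ → ℝ) : cfc f a v = ((f x : ℝ) : ℂ) • v := by
  rcases eq_or_ne v 0 with rfl | hv0
  · simp
  have hx : x ∈ spectrum ℝ a := by
    rw [← spectrum.preimage_algebraMap ℂ, Set.mem_preimage, ContinuousLinearMap.spectrum_eq]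
    exact (Module.End.hasEigenvalue_of_hasEigenvector
      (Module.End.hasEigenvector_iff.2 ⟨Module.End.mem_eigenspace_iff.2 hv, hv0⟩)).mem_spectrum
  -- The spectrum is finite, so a polynomial agrees with `f` on it; hence no continuity of `f` is
  -- needed.
  set q := Lagrange.interpolate (finite_real_spectrum a).toFinset id f
  have hq : ∀ y ∈ spectrum ℝ a, q.eval y = f y := fun y hy =>
    Lagrange.eval_interpolate_at_node (v := id) f (Set.injOn_id _) (by simpa using hy)
  rw [← hq x hx, ← aeval_apply_eigenvector hv q, ← cfc_polynomial q a]
  exact congrArg (· v) (cfc_congr fun y hy => (hq y hy).symm)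

lemma rpow_apply_eigenvector {a : K →L[ℂ] K} (ha : 0 ≤ a) {v : K} {x : ℝ}
    (hv : a v = (x : ℂ) • v) (y : ℝ) : (a ^ y) v = ((x ^ y : ℝ) : ℂ) • v := by
  rw [CFC.rpow_eq_cfc_real ha]
  exact cfc_apply_eigenvector ha.isSelfAdjoint hv (· ^ y)

lemma exp_neg_smul_apply_eigenvector {a : K →L[ℂ] K} (ha : IsSelfAdjoint a) {v : K} {x : ℝ}
    (hv : a v = (x : ℂ) • v) (s : ℝ) :
    NormedSpace.exp (-(s • a)) v = ((Real.exp (-(s * x)) : ℝ) : ℂ) • v := by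
  have hsa : IsSelfAdjoint (-(s • a)) := ((IsSelfAdjoint.all s).smul ha).neg
  rw [← CFC.real_exp_eq_normedSpace_exp hsa]
  apply cfc_apply_eigenvector hsa
  rw [neg_apply, smul_apply, hv, ← Complex.coe_smul,
    smul_smul, ← neg_smul]
  simp

end Spectral

/-! ### Traces and matrix elements between the two eigenbases. -/

section Coordinates

variable {K : Type*} [NormedAddCommGroup K] [InnerProductSpace ℂ K] [CompleteSpace K]
  {ι κ : Type*} [Fintype ι] [Fintype κ]
  {e : OrthonormalBasis ι ℂ K} {f : OrthonormalBasis κ ℂ K} {ρ ν : K →L[ℂ] K} {p : ι → ℝ} {q : κ → ℝ}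

/-- The trace in the eigenbasis is a `p`-weighted sum of `‖star A (e i)‖²`, which Parseval expands
in any second basis; this leaves `f` free to diagonalise `ν`. -/
lemma expect_mul_star_re (hρ : IsSelfAdjoint ρ) (he : ∀ i, ρ (e i) = (p i : ℂ) • e i)
    (f : OrthonormalBasis κ ℂ K) (A : K →L[ℂ] K) :
    (expect ρ (A * star A)).re = ∑ i, ∑ j, p i * ‖inner ℂ (e i) (A (f j))‖ ^ 2 := by
  rw [expect, opTrace, LinearMap.trace_eq_sum_inner _ e, Complex.re_sum]
  refine Finset.sum_congr rfl fun i _ => ?_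
  rw [ContinuousLinearMap.coe_coe, mul_apply_eq_comp,
    inner_apply_eigenvector hρ (he i), mul_apply_eq_comp,
    ← ContinuousLinearMap.adjoint_inner_left, ← ContinuousLinearMap.star_eq_adjoint,
    inner_self_eq_norm_sq_to_K, ← Finset.mul_sum]
  simp_rw [← ContinuousLinearMap.adjoint_inner_left, ← ContinuousLinearMap.star_eq_adjoint]
  rw [f.sum_sq_norm_inner_left]
  norm_cast
  exact Complex.re_ofReal_mul _ _

lemma expect_star_mul_re (hν : IsSelfAdjoint ν) (hf : ∀ j, ν (f j) = (q j : ℂ) • f j)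
    (e : OrthonormalBasis ι ℂ K) (A : K →L[ℂ] K) :
    (expect ν (star A * A)).re = ∑ i, ∑ j, q j * ‖inner ℂ (e i) (A (f j))‖ ^ 2 := by
  rw [expect, opTrace, LinearMap.trace_eq_sum_inner _ f, Complex.re_sum, Finset.sum_comm]
  refine Finset.sum_congr rfl fun j _ => ?_
  rw [ContinuousLinearMap.coe_coe, mul_apply_eq_comp,
    inner_apply_eigenvector hν (hf j), mul_apply_eq_comp,
    ContinuousLinearMap.star_eq_adjoint, ContinuousLinearMap.adjoint_inner_right,
    inner_self_eq_norm_sq_to_K, ← Finset.mul_sum, e.sum_sq_norm_inner_right]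
  norm_cast
  exact Complex.re_ofReal_mul _ _

variable [FiniteDimensional ℂ K]

lemma opTrace_rpow_mul_rpow_re (hρ : 0 ≤ ρ) (hν : 0 ≤ ν) (he : ∀ i, ρ (e i) = (p i : ℂ) • e i)
    (hf : ∀ j, ν (f j) = (q j : ℂ) • f j) (α β : ℝ) :
    (opTrace (ρ ^ α * ν ^ β)).re =
      ∑ i, ∑ j, p i ^ α * q j ^ β * ‖inner ℂ (e i) (f j)‖ ^ 2 := by
  rw [opTrace, LinearMap.trace_eq_sum_inner _ e, Complex.re_sum]
  refine Finset.sum_congr rfl fun i _ => ?_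
  rw [ContinuousLinearMap.coe_coe, mul_apply_eq_comp,
    inner_apply_eigenvector CFC.rpow_nonneg.isSelfAdjoint (rpow_apply_eigenvector hρ (he i) α),
    ← f.sum_inner_mul_inner, Complex.re_ofReal_mul, Complex.re_sum, Finset.mul_sum]
  refine Finset.sum_congr rfl fun j _ => ?_
  rw [inner_apply_eigenvector CFC.rpow_nonneg.isSelfAdjoint (rpow_apply_eigenvector hν (hf j) β),
    mul_left_comm, Complex.re_ofReal_mul, ← RCLike.re_eq_complex_re, inner_mul_symm_re_eq_norm,
    norm_mul, norm_inner_symm (f j) (e i)]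
  ring

lemma inner_optKernel (hρ : 0 ≤ ρ) (hν : 0 ≤ ν) (he : ∀ i, ρ (e i) = (p i : ℂ) • e i)
    (hf : ∀ j, ν (f j) = (q j : ℂ) • f j) (t s : ℝ) (i : ι) (j : κ) :
    inner ℂ (e i) (optKernel ρ ν t s (f j)) =
      ((q j * Real.exp (-(p i + t * q j) * s) : ℝ) : ℂ) * inner ℂ (e i) (f j) := by
  rw [optKernel, mul_assoc, mul_apply_eq_comp, mul_apply_eq_comp,
    exp_neg_smul_apply_eigenvector hν.isSelfAdjoint (hf j), map_smul, hf,
    inner_apply_eigenvector (exp_neg_smul_isSelfAdjoint hρ.isSelfAdjoint s)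
      (exp_neg_smul_apply_eigenvector hρ.isSelfAdjoint (he i) s), inner_smul_right,
    inner_smul_right, show -(p i + t * q j) * s = -(s * p i) + -(s * t * q j) by ring, Real.exp_add]
  push_cast
  ring

end Coordinates

/-! ### Scalar integrals and the scalar minimisation. -/

section Scalar

lemma integrableOn_mul_exp_neg {p q t : ℝ} (hp : 0 ≤ p) (hq : 0 ≤ q) (ht : 0 < t) :
    IntegrableOn (fun s => q * Real.exp (-(p + t * q) * s)) (Set.Ioi 0) := by
  rcases hq.eq_or_lt with rfl | hq
  · simp
  · exact (integrableOn_exp_mul_Ioi (by nlinarith [mul_pos ht hq]) 0).const_mul q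

lemma integral_mul_exp_neg {p q t : ℝ} (hp : 0 ≤ p) (hq : 0 ≤ q) (ht : 0 < t) :
    ∫ s in Set.Ioi (0 : ℝ), q * Real.exp (-(p + t * q) * s) = q / (p + t * q) := by
  rcases hq.eq_or_lt with rfl | hq
  · simp
  · rw [integral_const_mul, integral_exp_mul_Ioi (by nlinarith [mul_pos ht hq]) 0]
    rw [mul_zero, Real.exp_zero, neg_div_neg_eq, mul_one_div]

lemma lintegral_rpow_mul_exp_neg {a r : ℝ} (ha : 0 < a) (hr : 0 < r) :
    ∫⁻ t in Set.Ioi (0 : ℝ), ENNReal.ofReal (t ^ (a - 1) * Real.exp (-(r * t))) =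
      ENNReal.ofReal ((1 / r) ^ a * Real.Gamma a) := by
  have h := Real.integral_rpow_mul_exp_neg_mul_Ioi ha hr
  rw [← h, ofReal_integral_eq_lintegral_ofReal]
  -- A nonzero Bochner integral certifies integrability.
  · refine Integrable.of_integral_ne_zero ?_
    rw [h]
    exact (mul_pos (by positivity) (Real.Gamma_pos_of_pos ha)).ne'
  · filter_upwards [ae_restrict_mem measurableSet_Ioi] with t ht
    have : 0 < t := ht
    positivity

/-- The Mellin transform of `t ↦ pq / (p + tq)`. -/
lemma lintegral_rpow_mul_div_add {p q α : ℝ} (hp : 0 ≤ p) (hq : 0 ≤ q) (hα : α ∈ Set.Ioo (0 : ℝ) 1) :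
    ∫⁻ t in Set.Ioi (0 : ℝ), ENNReal.ofReal (t ^ (α - 1) * (p * q / (p + t * q))) =
      ENNReal.ofReal (Real.pi / Real.sin (Real.pi * α) * (p ^ α * q ^ (1 - α))) := by
  obtain ⟨h0, h1⟩ := hα
  rcases hp.eq_or_lt with rfl | hp
  · simp [Real.zero_rpow h0.ne']
  rcases hq.eq_or_lt with rfl | hq
  · simp [Real.zero_rpow (sub_pos.2 h1).ne']
  -- Write `q / (p + tq)` as a Laplace integral in `s`; after Tonelli both integrals are Gamma
  -- integrals, joined by the reflection formula.
  have inner_int : ∀ t ∈ Set.Ioi (0 : ℝ), ENNReal.ofReal (t ^ (α - 1) * (p * q / (p + t * q))) =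
      ∫⁻ s in Set.Ioi (0 : ℝ),
        ENNReal.ofReal (t ^ (α - 1) * (p * (q * Real.exp (-(p + t * q) * s)))) := by
    intro t (ht : 0 < t)
    rw [← ofReal_integral_eq_lintegral_ofReal, integral_const_mul, integral_const_mul,
      integral_mul_exp_neg hp.le hq.le ht, mul_div_assoc]
    · exact ((integrableOn_mul_exp_neg hp.le hq.le ht).const_mul _).const_mul _
    · exact ae_of_all _ fun s => by positivity
  rw [setLIntegral_congr_fun measurableSet_Ioi inner_int, lintegral_lintegral_swap
    (by fun_prop)]
  have swap_int : ∀ s ∈ Set.Ioi (0 : ℝ), ∫⁻ t in Set.Ioi (0 : ℝ),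
        ENNReal.ofReal (t ^ (α - 1) * (p * (q * Real.exp (-(p + t * q) * s)))) =
      ENNReal.ofReal (p * q ^ (1 - α) * Real.Gamma α) *
        ENNReal.ofReal (s ^ ((1 - α) - 1) * Real.exp (-(p * s))) := by
    intro s (hs : 0 < s)
    have h : ∀ t : ℝ, ENNReal.ofReal (t ^ (α - 1) * (p * (q * Real.exp (-(p + t * q) * s)))) =
        ENNReal.ofReal (p * q * Real.exp (-(p * s))) *
          ENNReal.ofReal (t ^ (α - 1) * Real.exp (-(q * s * t))) := by
      intro t
      rw [← ENNReal.ofReal_mul (by positivity),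
        show -(p + t * q) * s = -(p * s) + -(q * s * t) by ring, Real.exp_add]
      ring_nf
    simp_rw [h]
    rw [lintegral_const_mul _ (by fun_prop), lintegral_rpow_mul_exp_neg h0 (mul_pos hq hs),
      ← ENNReal.ofReal_mul (by positivity), ← ENNReal.ofReal_mul
        (mul_pos (by positivity) (Real.Gamma_pos_of_pos h0)).le]
    congr 1
    rw [one_div, Real.inv_rpow (by positivity), Real.mul_rpow hq.le hs.le,
      Real.rpow_sub hq, Real.rpow_one, show 1 - α - 1 = -α by ring, Real.rpow_neg hs.le]
    field_simp
  rw [setLIntegral_congr_fun measurableSet_Ioi swap_int, lintegral_const_mul _ (by fun_prop),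
    lintegral_rpow_mul_exp_neg (sub_pos.2 h1) hp, ← ENNReal.ofReal_mul
      (mul_pos (by positivity) (Real.Gamma_pos_of_pos h0)).le, ← Real.Gamma_mul_Gamma_one_sub]
  congr 1
  rw [one_div, Real.inv_rpow hp.le, Real.rpow_sub hp, Real.rpow_one]
  field_simp

/-- Completing the square in the matrix elements of the trial operator. -/
lemma quadratic_eq_add_sq {p q t : ℝ} (hp : 0 ≤ p) (hq : 0 ≤ q) (ht : 0 < t) (a c : ℂ) :
    t⁻¹ * (p * ‖a‖ ^ 2) + q * ‖c - a‖ ^ 2 =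
      p * q / (p + t * q) * ‖c‖ ^ 2 + (t⁻¹ * p + q) * ‖a - (t * q / (p + t * q) : ℝ) * c‖ ^ 2 := by
  -- If the denominator vanishes then `p = q = 0`, and both sides are zero.
  rcases (add_nonneg hp (mul_nonneg ht.le hq)).eq_or_lt with h | h
  · have hp0 : p = 0 := by nlinarith [mul_nonneg ht.le hq]
    have hq0 : q = 0 := by nlinarith [mul_nonneg ht.le hq]
    simp [hp0, hq0]
  · simp only [Complex.sq_norm, Complex.normSq_apply, Complex.sub_re, Complex.sub_im,
      Complex.re_ofReal_mul, Complex.im_ofReal_mul]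
    field_simp
    ring

/-- The continuous extension to `[0, ∞[` of the function `t ↦ tq / (p + tq)`. -/
noncomputable def optWeight (p q t : ℝ) : ℝ :=
  -- For `p = 0 < q` the quotient is `1` at every `t > 0` but `0 / 0 = 0` at `t = 0`, so it must be
  -- replaced there.
  if p = 0 then (if q = 0 then 0 else 1) else t * q / (p + t * q)

lemma optWeight_of_pos {p q t : ℝ} (ht : 0 < t) : optWeight p q t = t * q / (p + t * q) := by
  unfold optWeight
  split_ifs with hp hq
  · simp [hq]
  · rw [hp, zero_add, div_self (mul_ne_zero ht.ne' hq)]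
  · rfl

lemma continuousOn_optWeight {p q : ℝ} (hp : 0 ≤ p) (hq : 0 ≤ q) :
    ContinuousOn (optWeight p q) (Set.Ici 0) := by
  unfold optWeight
  split_ifs with h h'
  · exact continuousOn_const
  · exact continuousOn_const
  · refine ContinuousOn.div (by fun_prop) (by fun_prop) fun t ht => ?_
    have : 0 ≤ t * q := mul_nonneg ht hq
    have : 0 < p := hp.lt_of_ne' h
    positivity

end Scalar

/-! ### The variational principle, the optimizer and uniqueness. -/

section Variational

variable {K : Type*} [NormedAddCommGroup K] [InnerProductSpace ℂ K]
  {ι κ : Type*} [Fintype ι] [Fintype κ]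

/-- The continuous extension of the optimizer to `[0, ∞[`, in terms of the eigenbases `e`, `f` and
the eigenvalues `p`, `q` of the two states. -/
noncomputable def optExtension (e : OrthonormalBasis ι ℂ K) (f : OrthonormalBasis κ ℂ K)
    (p : ι → ℝ) (q : κ → ℝ) (t : ℝ) : K →L[ℂ] K :=
  ∑ i, ∑ j, ((optWeight (p i) (q j) t : ℂ) * inner ℂ (e i) (f j)) • rankOne ℂ (e i) (f j)

lemma inner_optExtension (e : OrthonormalBasis ι ℂ K) (f : OrthonormalBasis κ ℂ K)
    (p : ι → ℝ) (q : κ → ℝ) (t : ℝ) (i : ι) (j : κ) :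
    inner ℂ (e i) (optExtension e f p q t (f j)) =
      (optWeight (p i) (q j) t : ℂ) * inner ℂ (e i) (f j) :=
  inner_sum_rankOne e f _ i j

variable {e : OrthonormalBasis ι ℂ K} {f : OrthonormalBasis κ ℂ K} {ρ ν : K →L[ℂ] K}
  {p : ι → ℝ} {q : κ → ℝ}

lemma continuousOn_optExtension (hp : ∀ i, 0 ≤ p i) (hq : ∀ j, 0 ≤ q j) :
    ContinuousOn (optExtension e f p q) (Set.Ici 0) := by
  refine continuousOn_finsetSum _ fun i _ => continuousOn_finsetSum _ fun j _ => ?_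
  have := continuousOn_optWeight (hp i) (hq j)
  exact ((Complex.continuous_ofReal.comp_continuousOn this).mul continuousOn_const).smul
    continuousOn_const

variable [CompleteSpace K]

/-- The integrand is a minimal value, not depending on the trial operator, plus weighted squared
distances of the matrix elements from those of the optimizer. -/
lemma integrand_eq (hρ : IsSelfAdjoint ρ) (hν : IsSelfAdjoint ν)
    (he : ∀ i, ρ (e i) = (p i : ℂ) • e i) (hf : ∀ j, ν (f j) = (q j : ℂ) • f j)
    (hp : ∀ i, 0 ≤ p i) (hq : ∀ j, 0 ≤ q j) (α : ℝ) {t : ℝ} (ht : 0 < t) (X : K →L[ℂ] K) :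
    integrand α ρ ν t X =
      (∑ i, ∑ j, ‖inner ℂ (e i) (f j)‖ ^ 2 * (t ^ (α - 1) * (p i * q j / (p i + t * q j)))) +
      t ^ (α - 1) * ∑ i, ∑ j, (t⁻¹ * p i + q j) *
        ‖inner ℂ (e i) (X (f j)) - inner ℂ (e i) (optExtension e f p q t (f j))‖ ^ 2 := by
  rw [integrand, CFC.abs_sq, CFC.abs_sq, star_star, expect_mul_star_re hρ he f,
    expect_star_mul_re hν hf e]
  simp only [Finset.mul_sum, ← Finset.sum_add_distrib]
  refine Finset.sum_congr rfl fun i _ => Finset.sum_congr rfl fun j _ => ?_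
  have h := quadratic_eq_add_sq (hp i) (hq j) ht (inner ℂ (e i) (X (f j))) (inner ℂ (e i) (f j))
  rw [inner_optExtension, optWeight_of_pos ht, sub_apply, inner_sub_right, one_apply_eq_self, h]
  ring

lemma integrand_optExtension_le (hρ : IsSelfAdjoint ρ) (hν : IsSelfAdjoint ν)
    (he : ∀ i, ρ (e i) = (p i : ℂ) • e i) (hf : ∀ j, ν (f j) = (q j : ℂ) • f j)
    (hp : ∀ i, 0 ≤ p i) (hq : ∀ j, 0 ≤ q j) (α : ℝ) {t : ℝ} (ht : 0 < t) (X : K →L[ℂ] K) :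
    integrand α ρ ν t (optExtension e f p q t) ≤ integrand α ρ ν t X := by
  rw [integrand_eq hρ hν he hf hp hq α ht, integrand_eq hρ hν he hf hp hq α ht X]
  simp only [sub_self, norm_zero, ne_eq, OfNat.ofNat_ne_zero, not_false_eq_true, zero_pow, mul_zero,
    Finset.sum_const_zero, add_zero, le_add_iff_nonneg_right]
  exact mul_nonneg (by positivity) (Finset.sum_nonneg fun i _ => Finset.sum_nonneg fun j _ =>
    mul_nonneg (add_nonneg (mul_nonneg (by positivity) (hp i)) (hq j)) (by positivity))

lemma eq_optExtension_of_integrand_le (hρ : IsSelfAdjoint ρ) (hν : IsSelfAdjoint ν)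
    (he : ∀ i, ρ (e i) = (p i : ℂ) • e i) (hf : ∀ j, ν (f j) = (q j : ℂ) • f j)
    (hp : ∀ i, 0 ≤ p i) (hq : ∀ j, 0 ≤ q j) (hpq : (∀ i, p i ≠ 0) ∨ ∀ j, q j ≠ 0)
    (α : ℝ) {t : ℝ} (ht : 0 < t) {X : K →L[ℂ] K}
    (hX : integrand α ρ ν t X ≤ integrand α ρ ν t (optExtension e f p q t)) :
    X = optExtension e f p q t := by
  have hw : ∀ i j, 0 < t⁻¹ * p i + q j := fun i j => by
    rcases hpq with h | h
    · exact add_pos_of_pos_of_nonneg (mul_pos (by positivity) ((hp i).lt_of_ne' (h i))) (hq j)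
    · exact add_pos_of_nonneg_of_pos (mul_nonneg (by positivity) (hp i)) ((hq j).lt_of_ne' (h j))
  rw [integrand_eq hρ hν he hf hp hq α ht, integrand_eq hρ hν he hf hp hq α ht
    (optExtension e f p q t)] at hX
  simp only [sub_self, norm_zero, ne_eq, OfNat.ofNat_ne_zero, not_false_eq_true, zero_pow, mul_zero,
    Finset.sum_const_zero, add_zero, add_le_iff_nonpos_right] at hX
  have hnn : ∀ i j, 0 ≤ (t⁻¹ * p i + q j) *
      ‖inner ℂ (e i) (X (f j)) - inner ℂ (e i) (optExtension e f p q t (f j))‖ ^ 2 :=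
    fun i j => mul_nonneg (hw i j).le (by positivity)
  have hsum := le_antisymm (nonpos_of_mul_nonpos_right hX (Real.rpow_pos_of_pos ht _))
    (Finset.sum_nonneg fun i _ => Finset.sum_nonneg fun j _ => hnn i j)
  refine ext_inner_basis e f fun i j => ?_
  have h1 := (Finset.sum_eq_zero_iff_of_nonneg fun i _ =>
    Finset.sum_nonneg fun j _ => hnn i j).1 hsum i (Finset.mem_univ _)
  have h2 := (Finset.sum_eq_zero_iff_of_nonneg fun j _ => hnn i j).1 h1 j (Finset.mem_univ _)
  simpa [(hw i j).ne', sub_eq_zero] using h2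

/-- The minimisation is pointwise in `t`, so no regularity of `A` enters. -/
lemma functional_optExtension_le (hρ : 0 ≤ ρ) (hν : 0 ≤ ν)
    (he : ∀ i, ρ (e i) = (p i : ℂ) • e i) (hf : ∀ j, ν (f j) = (q j : ℂ) • f j)
    (hp : ∀ i, 0 ≤ p i) (hq : ∀ j, 0 ≤ q j) (α : ℝ) (A : ℝ → K →L[ℂ] K) :
    functional α ρ ν (optExtension e f p q) ≤ functional α ρ ν A :=
  ENNReal.log_monotone <| mul_le_mul_right (setLIntegral_mono' measurableSet_Ioi fun _ ht =>
    ENNReal.ofReal_le_ofReal (integrand_optExtension_le hρ.isSelfAdjoint hν.isSelfAdjoint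
      he hf hp hq α ht _)) _

variable [FiniteDimensional ℂ K]

lemma lintegral_integrand_optExtension (hρ : 0 ≤ ρ) (hν : 0 ≤ ν)
    (he : ∀ i, ρ (e i) = (p i : ℂ) • e i) (hf : ∀ j, ν (f j) = (q j : ℂ) • f j)
    (hp : ∀ i, 0 ≤ p i) (hq : ∀ j, 0 ≤ q j) {α : ℝ} (hα : α ∈ Set.Ioo (0 : ℝ) 1) :
    ∫⁻ t in Set.Ioi (0 : ℝ), ENNReal.ofReal (integrand α ρ ν t (optExtension e f p q t)) =
      ENNReal.ofReal (Real.pi / Real.sin (Real.pi * α) *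
        (opTrace (ρ ^ α * ν ^ (1 - α))).re) := by
  have hsin : 0 < Real.sin (Real.pi * α) := Real.sin_pos_of_pos_of_lt_pi
    (mul_pos Real.pi_pos hα.1) (mul_lt_of_lt_one_right Real.pi_pos hα.2)
  have h : ∀ t ∈ Set.Ioi (0 : ℝ), ENNReal.ofReal (integrand α ρ ν t (optExtension e f p q t)) =
      ∑ i, ∑ j, ENNReal.ofReal (‖inner ℂ (e i) (f j)‖ ^ 2) *
        ENNReal.ofReal (t ^ (α - 1) * (p i * q j / (p i + t * q j))) := by
    intro t (ht : 0 < t)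
    have hnn : ∀ i j, 0 ≤ ‖inner ℂ (e i) (f j)‖ ^ 2 *
        (t ^ (α - 1) * (p i * q j / (p i + t * q j))) := fun i j => by
      have := hp i
      have := hq j
      positivity
    rw [integrand_eq hρ.isSelfAdjoint hν.isSelfAdjoint he hf hp hq α ht]
    simp only [sub_self, norm_zero, ne_eq, OfNat.ofNat_ne_zero, not_false_eq_true, zero_pow,
      mul_zero, Finset.sum_const_zero, add_zero]
    rw [ENNReal.ofReal_sum_of_nonneg fun i _ => Finset.sum_nonneg fun j _ => hnn i j]
    refine Finset.sum_congr rfl fun i _ => ?_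
    rw [ENNReal.ofReal_sum_of_nonneg fun j _ => hnn i j]
    exact Finset.sum_congr rfl fun j _ => ENNReal.ofReal_mul (by positivity)
  have hnn : ∀ i j, 0 ≤ Real.pi / Real.sin (Real.pi * α) *
      (p i ^ α * q j ^ (1 - α) * ‖inner ℂ (e i) (f j)‖ ^ 2) := fun i j => by
    have := hp i
    have := hq j
    positivity
  rw [setLIntegral_congr_fun measurableSet_Ioi h, lintegral_finsetSum _ (by fun_prop),
    opTrace_rpow_mul_rpow_re hρ hν he hf]
  simp only [Finset.mul_sum]
  rw [ENNReal.ofReal_sum_of_nonneg fun i _ => Finset.sum_nonneg fun j _ => hnn i j]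
  refine Finset.sum_congr rfl fun i _ => ?_
  rw [lintegral_finsetSum _ (by fun_prop), ENNReal.ofReal_sum_of_nonneg fun j _ => hnn i j]
  refine Finset.sum_congr rfl fun j _ => ?_
  rw [lintegral_const_mul _ (by fun_prop), lintegral_rpow_mul_div_add (hp i) (hq j) hα,
    ← ENNReal.ofReal_mul (by positivity)]
  ring_nf

/-- Reduces convergence and evaluation of the operator integral to finitely many scalar
exponentials. -/
lemma optKernel_eq_sum (hρ : 0 ≤ ρ) (hν : 0 ≤ ν)
    (he : ∀ i, ρ (e i) = (p i : ℂ) • e i) (hf : ∀ j, ν (f j) = (q j : ℂ) • f j) (t s : ℝ) :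
    optKernel ρ ν t s = ∑ i, ∑ j, (q j * Real.exp (-(p i + t * q j) * s)) •
      ((inner ℂ (e i) (f j) : ℂ) • rankOne ℂ (e i) (f j)) := by
  refine ext_inner_basis e f fun i j => ?_
  simp_rw [← Complex.coe_smul, smul_smul]
  rw [inner_sum_rankOne e f, inner_optKernel hρ hν he hf]

lemma integrableOn_optKernel (hρ : 0 ≤ ρ) (hν : 0 ≤ ν)
    (he : ∀ i, ρ (e i) = (p i : ℂ) • e i) (hf : ∀ j, ν (f j) = (q j : ℂ) • f j)
    (hp : ∀ i, 0 ≤ p i) (hq : ∀ j, 0 ≤ q j) {t : ℝ} (ht : 0 < t) :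
    IntegrableOn (optKernel ρ ν t) (Set.Ioi 0) := by
  rw [funext (optKernel_eq_sum hρ hν he hf t)]
  exact integrable_finsetSum _ fun i _ => integrable_finsetSum _ fun j _ =>
    (integrableOn_mul_exp_neg (hp i) (hq j) ht).smul_const _

lemma optExtension_eq_optimizer (hρ : 0 ≤ ρ) (hν : 0 ≤ ν)
    (he : ∀ i, ρ (e i) = (p i : ℂ) • e i) (hf : ∀ j, ν (f j) = (q j : ℂ) • f j)
    (hp : ∀ i, 0 ≤ p i) (hq : ∀ j, 0 ≤ q j) {t : ℝ} (ht : 0 < t) :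
    optExtension e f p q t = optimizer ρ ν t := by
  have hint : ∀ i j, Integrable (fun s : ℝ => (q j * Real.exp (-(p i + t * q j) * s)) •
      ((inner ℂ (e i) (f j) : ℂ) • rankOne ℂ (e i) (f j))) (volume.restrict (Set.Ioi 0)) :=
    fun i j => (integrableOn_mul_exp_neg (hp i) (hq j) ht).smul_const _
  rw [optimizer, funext (optKernel_eq_sum hρ hν he hf t),
    integral_finsetSum _ fun i _ => integrable_finsetSum _ fun j _ => hint i j, Finset.smul_sum]
  refine Finset.sum_congr rfl fun i _ => ?_
  rw [integral_finsetSum _ fun j _ => hint i j, Finset.smul_sum]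
  refine Finset.sum_congr rfl fun j _ => ?_
  rw [integral_smul_const, integral_mul_exp_neg (hp i) (hq j) ht, optWeight_of_pos ht, smul_smul,
    ← Complex.coe_smul, smul_smul, mul_div_assoc]

lemma aemeasurable_integrand (α : ℝ) {A : ℝ → K →L[ℂ] K}
    (hA : ContinuousOn A (Set.Ioi 0)) :
    AEMeasurable (fun t => ENNReal.ofReal (integrand α ρ ν t (A t)))
      (volume.restrict (Set.Ioi 0)) := by
  have hexp : ∀ σ : K →L[ℂ] K, Continuous (expect σ) := fun σ =>
    (LinearMap.continuous_of_finiteDimensional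
      (LinearMap.trace ℂ K ∘ₗ ContinuousLinearMap.coeLM ℂ)).comp (continuous_const.mul continuous_id)
  refine (ContinuousOn.aemeasurable ?_ measurableSet_Ioi).ennreal_ofReal
  simp only [integrand, CFC.abs_sq, star_star]
  refine (continuousOn_id.rpow_const fun t ht => Or.inl (ne_of_gt ht)).mul
    (((continuousOn_inv₀.mono fun t ht => ne_of_gt ht).mul ?_).add ?_)
  · exact (Complex.continuous_re.comp (hexp ρ)).comp_continuousOn (hA.mul hA.star)
  · exact (Complex.continuous_re.comp (hexp ν)).comp_continuousOn
      ((continuousOn_const.sub hA).star.mul (continuousOn_const.sub hA))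

lemma functional_optExtension (hρ : 0 ≤ ρ) (hν : 0 ≤ ν)
    (he : ∀ i, ρ (e i) = (p i : ℂ) • e i) (hf : ∀ j, ν (f j) = (q j : ℂ) • f j)
    (hp : ∀ i, 0 ≤ p i) (hq : ∀ j, 0 ≤ q j) {α : ℝ} (hα : α ∈ Set.Ioo (0 : ℝ) 1) :
    functional α ρ ν (optExtension e f p q) = renyi α ρ ν := by
  have hsin : 0 < Real.sin (Real.pi * α) := Real.sin_pos_of_pos_of_lt_pi
    (mul_pos Real.pi_pos hα.1) (mul_lt_of_lt_one_right Real.pi_pos hα.2)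
  rw [functional, renyi, lintegral_integrand_optExtension hρ hν he hf hp hq hα,
    ← ENNReal.ofReal_mul (by positivity)]
  congr 2
  field_simp

/-- Ordered integrands with equal finite integrals agree almost everywhere, and continuous functions
agreeing almost everywhere on an open set agree on it. -/
lemma eqOn_optExtension_of_functional_eq (hρ : 0 ≤ ρ) (hν : 0 ≤ ν)
    (he : ∀ i, ρ (e i) = (p i : ℂ) • e i) (hf : ∀ j, ν (f j) = (q j : ℂ) • f j)
    (hp : ∀ i, 0 ≤ p i) (hq : ∀ j, 0 ≤ q j) (hpq : (∀ i, p i ≠ 0) ∨ ∀ j, q j ≠ 0)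
    {α : ℝ} (hα : α ∈ Set.Ioo (0 : ℝ) 1) {A : ℝ → K →L[ℂ] K} (hA : ContinuousOn A (Set.Ioi 0))
    (h : functional α ρ ν A = functional α ρ ν (optExtension e f p q)) :
    Set.EqOn A (optExtension e f p q) (Set.Ioi 0) := by
  have hsin : 0 < Real.sin (Real.pi * α) := Real.sin_pos_of_pos_of_lt_pi
    (mul_pos Real.pi_pos hα.1) (mul_lt_of_lt_one_right Real.pi_pos hα.2)
  have hle : ∀ t ∈ Set.Ioi (0 : ℝ), integrand α ρ ν t (optExtension e f p q t) ≤
      integrand α ρ ν t (A t) := fun t ht =>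
    integrand_optExtension_le hρ.isSelfAdjoint hν.isSelfAdjoint he hf hp hq α ht _
  have hlint := (ENNReal.mul_right_inj (by simpa using div_pos hsin Real.pi_pos)
    ENNReal.ofReal_ne_top).1 (ENNReal.log_injective h)
  have hae := ae_eq_of_ae_le_of_lintegral_le
    (((ae_restrict_mem measurableSet_Ioi).mono fun t ht => ENNReal.ofReal_le_ofReal (hle t ht)))
    (by rw [lintegral_integrand_optExtension hρ hν he hf hp hq hα]; exact ENNReal.ofReal_ne_top)
    (aemeasurable_integrand α hA) hlint.le
  refine Measure.eqOn_open_of_ae_eq (μ := volume) ?_ isOpen_Ioi hA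
    ((continuousOn_optExtension hp hq).mono Set.Ioi_subset_Ici_self)
  filter_upwards [hae, ae_restrict_mem measurableSet_Ioi] with t heq ht
  refine eq_optExtension_of_integrand_le hρ.isSelfAdjoint hν.isSelfAdjoint he hf hp hq hpq α ht ?_
  -- `ENNReal.ofReal` is injective only on non-negative reals.
  have hnn : 0 ≤ integrand α ρ ν t (optExtension e f p q t) := by
    rw [integrand, CFC.abs_sq, CFC.abs_sq, star_star, expect_mul_star_re hρ.isSelfAdjoint he f,
      expect_star_mul_re hν.isSelfAdjoint hf e]
    have : 0 < t := ht
    refine mul_nonneg (by positivity) (add_nonneg (mul_nonneg (by positivity) ?_) ?_)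
    · exact Finset.sum_nonneg fun i _ => Finset.sum_nonneg fun j _ =>
        mul_nonneg (hp i) (by positivity)
    · exact Finset.sum_nonneg fun i _ => Finset.sum_nonneg fun j _ =>
        mul_nonneg (hq j) (by positivity)
  exact ((ENNReal.ofReal_eq_ofReal_iff hnn (hnn.trans (hle t ht))).1 heq).ge

end Variational

end Kosaki

theorem theorem2p9 {K : Type*} [NormedAddCommGroup K] [InnerProductSpace ℂ K]
    [FiniteDimensional ℂ K] [CompleteSpace K]
    (ρ ν : K →L[ℂ] K) (hρ : Kosaki.IsState ρ) (hν : Kosaki.IsState ν)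
    (α : ℝ) (hα : α ∈ Set.Ioo (0 : ℝ) 1)
    -- the half-line on which the trial functions live: both readings are covered
    (D : Set ℝ) (hD : D = Set.Ici 0 ∨ D = Set.Ioi 0) :
    -- the variational formula
    Kosaki.renyi α ρ ν =
      ⨅ A ∈ {A : ℝ → K →L[ℂ] K | ContinuousOn A D}, Kosaki.functional α ρ ν A ∧
    -- the integral that defines the optimizer converges
    (∀ t : ℝ, 0 < t →
      MeasureTheory.IntegrableOn (Kosaki.optKernel ρ ν t) (Set.Ioi 0)) ∧
    -- the infimum is achieved by the optimizer, uniquely if one of the states is faithful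
    ∃ Aopt : ℝ → K →L[ℂ] K, ContinuousOn Aopt D ∧
      (∀ t : ℝ, 0 < t → Aopt t = Kosaki.optimizer ρ ν t) ∧
      Kosaki.functional α ρ ν Aopt = Kosaki.renyi α ρ ν ∧
      (Kosaki.IsFaithful ρ ∨ Kosaki.IsFaithful ν →
        ∀ A : ℝ → K →L[ℂ] K, ContinuousOn A D →
          Kosaki.functional α ρ ν A = Kosaki.renyi α ρ ν → Set.EqOn A Aopt D) := by
  obtain ⟨e, p, hp, he⟩ := Kosaki.exists_eigenbasis hρ.1
  obtain ⟨f, q, hq, hf⟩ := Kosaki.exists_eigenbasis hν.1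
  have hIci : D ⊆ Set.Ici 0 := by
    rcases hD with rfl | rfl
    exacts [le_rfl, Set.Ioi_subset_Ici_self]
  have hIoi : Set.Ioi 0 ⊆ D := by
    rcases hD with rfl | rfl
    exacts [Set.Ioi_subset_Ici_self, le_rfl]
  have hcont := (Kosaki.continuousOn_optExtension (e := e) (f := f) hp hq).mono hIci
  have hopt := Kosaki.functional_optExtension hρ.1 hν.1 he hf hp hq hα
  refine ⟨le_antisymm (le_iInf₂ fun A _ => ?_) ?_,
    fun t ht => Kosaki.integrableOn_optKernel hρ.1 hν.1 he hf hp hq ht,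
    Kosaki.optExtension e f p q, hcont,
    fun t ht => Kosaki.optExtension_eq_optimizer hρ.1 hν.1 he hf hp hq ht, hopt,
    fun hfaith A hA hAopt => ?_⟩
  · exact hopt ▸ Kosaki.functional_optExtension_le hρ.1 hν.1 he hf hp hq α A
  · exact hopt ▸ iInf₂_le (Kosaki.optExtension e f p q) hcont
  · have hpq := hfaith.imp
      (fun h i => h.eigenvalue_ne_zero (e.orthonormal.ne_zero i) (he i))
      (fun h j => h.eigenvalue_ne_zero (f.orthonormal.ne_zero j) (hf j))
    -- The integral does not see `t = 0`; if `0 ∈ D`, equality there follows by continuity.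
    refine (Kosaki.eqOn_optExtension_of_functional_eq hρ.1 hν.1 he hf hp hq hpq hα
      (hA.mono hIoi) (hAopt.trans hopt.symm)).of_subset_closure hA hcont hIoi ?_
    rwa [closure_Ioi]
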